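/- For integers $n,k$, let $[n]=\{1,\dots,n\}$ and let $\binom{[n]}{k}$ be the collection of all $k$-element subsets of $[n]$. A family $\mathcal F\subset\binom{[n]}{k}$ is intersecting if any two of its members have non-empty intersection. The diversity of $\mathcal F$ is $\gamma(\mathcal F)=|\mathcal F|-\Delta(\mathcal F)$, where $\Delta(\mathcal F)=\max_{i\in[n]}|\{F\in\mathcal F: i\in F\}|$ is the maximal degree. Let $n>2k\ge 8$ and let $\mathcal F\subset\binom{[n]}{k}$ be an intersecting family. Suppose that $\gamma(\mathcal F)>\binom{n-u-1}{n-k-1}$ for some integer $4\le u\le k$. Then $$|\mathcal F|\le \binom{n-1}{k-1}+\binom{n-u-1}{n-k-1}-\binom{n-u-1}{k-1}-\binom{n-k-2}{k-2}+1.\qquad (*)$$ Moreover, for $n>2k\ge 6$ and an intersecting family $\mathcal F\subset\binom{[n]}{k}$, the inequality $(*)$ holds with $u=3$ if $$\binom{n-4}{k-3}<\gamma(\mathcal F)\le\binom{n-3}{k-2}-\binom{n-k-2}{k-2}+1$$ or $$\binom{n-3}{k-2}<\gamma(\mathcal F)\le\binom{n-3}{k-2}+\binom{n-4}{k-2}-\binom{n-k-2}{k-2}+1.$$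 -/

import Mathlib

/-- The degree of `i` in the family `F`: the number of members of `F` that contain `i`. -/
def familyDegree {n : ℕ} (F : Finset (Finset (Fin n))) (i : Fin n) : ℕ :=
  (F.filter (fun A => i ∈ A)).card

/-- The maximal degree of an element of the ground set in the family `F`. -/
def familyMaxDegree {n : ℕ} (F : Finset (Finset (Fin n))) : ℕ :=
  Finset.univ.sup (familyDegree F)

theorem familyMaxDegree_le_card {n : ℕ} (F : Finset (Finset (Fin n))) :
    familyMaxDegree F ≤ F.card :=
  Finset.sup_le fun _ _ => Finset.card_filter_le _ _

/-- The diversity of `F`: the number of members of `F` minus the maximal degree.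
The subtraction never truncates, by `familyMaxDegree_le_card`. -/
def diversity {n : ℕ} (F : Finset (Finset (Fin n))) : ℕ :=
  F.card - familyMaxDegree F

/-! Split F at a vertex p of maximal degree. The links of the members through p and the members
avoiding p are cross-intersecting families of (k-1)-sets and k-sets on n-1 points, and the second
has size γ(F). So the task is to bound the size s of the first in terms of the size t = γ(F) of the
second.

By Kruskal-Katona the complements of the second family may be taken to form an initial colex
segment. According to the size t, either all its sets contain the last point (`pass_to_link`), or it
has every set through that point and then all sets of the first family contain it
(`pass_to_deletion`). The threshold C(n-u-1, n-k-1) counts the k-sets that avoid p and contain u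
fixed points. If γ lies between the thresholds for u and u-1, then u-1 links and one deletion lead
to the Hilton-Milner bound `add_le_of_pos`. If γ exceeds the threshold for u-1, the bound for u-1
holds and is stronger.

The descent ends at u = 3, with the bound `card_add_choose_le_of_choose_lt_diversity` by the size of
{A : |A ∩ T| ≥ 2}, |T| = 3. For γ ≤ C(n-3,k-2) + C(n-4,k-2) links and deletions still prove it. For
larger γ the family is compressed: a single compression keeps |F|, and γ, though it may fall, stays
above C(n-4,k-3), so the induction continues. A fully shifted family is counted by its traces on the
two smallest points (`card_le_of_isShiftedOn`). -/

open Finset in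
/-- There are cross-intersecting families of subsets of an `N`-element set, one of at least `s`
sets of size `a` and one of exactly `t` sets of size `b`. -/
def CrossIntersectingSizes (N a b s t : ℕ) : Prop :=
  ∃ A B : Finset (Finset (Fin N)), (∀ X ∈ A, #X = a) ∧ (∀ Y ∈ B, #Y = b) ∧
    (∀ X ∈ A, ∀ Y ∈ B, ¬ Disjoint X Y) ∧ s ≤ #A ∧ #B = t

/-! ### Cross-intersecting families: reduction to colex initial segments -/

namespace CrossIntersectingSizes

open Finset
open scoped FinsetFamily

theorem of_finset {α : Type*} [DecidableEq α] {N a b : ℕ} (S : Finset α) (hS : #S = N)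
    {A B : Finset (Finset α)} (hA : A ⊆ powersetCard a S) (hB : B ⊆ powersetCard b S)
    (hAB : ∀ X ∈ A, ∀ Y ∈ B, ¬ Disjoint X Y) : CrossIntersectingSizes N a b #A #B := by
  subst hS
  let f : Fin #S ↪ α := S.equivFin.symm.toEmbedding.trans (Function.Embedding.subtype _)
  let φ : Finset α → Finset (Fin #S) := fun X => univ.filter (fun i => f i ∈ X)
  have hφ : ∀ X ⊆ S, (φ X).map f = X := by
    intro X hX
    ext x
    simp only [mem_map, φ, mem_filter, mem_univ, true_and]
    constructor
    · rintro ⟨i, hi, rfl⟩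
      exact hi
    · intro hx
      have : f (S.equivFin ⟨x, hX hx⟩) = x := by simp [f]
      exact ⟨_, by rwa [this], this⟩
  have hcard : ∀ X ⊆ S, #(φ X) = #X := fun X hX => by
    rw [← card_map f, hφ X hX]
  have hinj : ∀ C : Finset (Finset α), (∀ X ∈ C, X ⊆ S) → #(C.image φ) = #C := fun C hC => by
    apply card_image_of_injOn
    intro X hX Y hY h
    rw [← hφ X (hC X hX), ← hφ Y (hC Y hY)]
    exact congrArg _ h
  have hA' := fun X hX => mem_powersetCard.1 (hA (show X ∈ A from hX))
  have hB' := fun X hX => mem_powersetCard.1 (hB (show X ∈ B from hX))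
  refine ⟨A.image φ, B.image φ, ?_, ?_, ?_, (hinj A fun X hX => (hA' X hX).1).ge,
    hinj B fun X hX => (hB' X hX).1⟩
  · intro X₀ hX₀
    obtain ⟨X, hX, rfl⟩ := mem_image.1 hX₀
    rw [hcard X (hA' X hX).1, (hA' X hX).2]
  · intro X₀ hX₀
    obtain ⟨X, hX, rfl⟩ := mem_image.1 hX₀
    rw [hcard X (hB' X hX).1, (hB' X hX).2]
  · intro X₀ hX₀ Y₀ hY₀
    obtain ⟨X, hX, rfl⟩ := mem_image.1 hX₀
    obtain ⟨Y, hY, rfl⟩ := mem_image.1 hY₀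
    rw [← disjoint_map f, hφ X (hA' X hX).1, hφ Y (hB' Y hY).1]
    exact hAB X hX Y hY

theorem mono {N a b s s' t t' : ℕ} (h : CrossIntersectingSizes N a b s t) (hs : s' ≤ s)
    (ht : t' ≤ t) : CrossIntersectingSizes N a b s' t' := by
  obtain ⟨A, B, hA, hB, hAB, hsA, rfl⟩ := h
  obtain ⟨C, hC, rfl⟩ := exists_subset_card_eq ht
  exact ⟨A, C, hA, fun Y hY => hB Y (hC hY), fun X hX Y hY => hAB X hX Y (hC hY), hs.trans hsA, rfl⟩

theorem symm {N a b s t : ℕ} (h : CrossIntersectingSizes N a b s t) :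
    CrossIntersectingSizes N b a t s := by
  obtain ⟨A, B, hA, hB, hAB, hsA, rfl⟩ := h
  obtain ⟨C, hC, rfl⟩ := exists_subset_card_eq hsA
  exact ⟨B, C, hB, fun Y hY => hA Y (hC hY), fun X hX Y hY h => hAB Y (hC hY) X hX h.symm, le_rfl,
    rfl⟩

/-- Initial segments grow one set at a time, by adding the colex-least missing r-set. -/
theorem exists_isInitSeg_card_eq {N r t : ℕ} (ht : t ≤ N.choose r) :
    ∃ C : Finset (Finset (Fin N)), Colex.IsInitSeg C r ∧ #C = t := by
  induction t with
  | zero => exact ⟨∅, by simp, rfl⟩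
  | succ t ih =>
    obtain ⟨C, hC, hCt⟩ := ih (by omega)
    have hne : ((powersetCard r univ \ C).image toColex).Nonempty := by
      rw [image_nonempty]
      by_contra! h
      have := card_le_card (sdiff_eq_empty_iff_subset.1 h)
      rw [card_powersetCard, card_fin] at this
      omega
    obtain ⟨m, hm, hmin⟩ := exists_min_image _ id hne
    obtain ⟨s, hs, rfl⟩ := mem_image.1 hm
    simp only [mem_sdiff, mem_powersetCard, subset_univ, true_and] at hs
    refine ⟨insert s C, ⟨?_, ?_⟩, by rw [card_insert_of_notMem hs.2, hCt]⟩
    · intro x hx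
      rcases mem_insert.1 hx with rfl | hx
      · exact hs.1
      · exact hC.1 hx
    · rintro x y hx ⟨hyx, hy⟩
      rcases mem_insert.1 hx with rfl | hx
      · by_contra hyC
        have := hmin (toColex y) (mem_image_of_mem _ (by
          simp only [mem_sdiff, mem_powersetCard, subset_univ, true_and]
          exact ⟨hy, fun h => hyC (mem_insert_of_mem h)⟩))
        exact absurd hyx (not_lt.2 this)
      · exact mem_insert_of_mem (hC.2 hx ⟨hyx, hy⟩)

/-- By the Kruskal-Katona theorem, the complements of one of the two families may be taken to be
an initial segment of the colexicographic order. -/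
theorem exists_isInitSeg {N a b s t : ℕ} (h : CrossIntersectingSizes N a b s t) (hab : a + b ≤ N) :
    ∃ C : Finset (Finset (Fin N)), Colex.IsInitSeg C (N - b) ∧ #C = t ∧
      s ≤ #((powersetCard a univ).filter (fun X : Finset (Fin N) => ∀ Y ∈ C, ¬ X ⊆ Y)) := by
  obtain ⟨A, B, hA, hB, hAB, hsA, rfl⟩ := h
  have hBs : (B : Set (Finset (Fin N))).Sized b := fun Y hY => hB Y hY
  have hBc : ((Bᶜˢ : Finset (Finset (Fin N))) : Set (Finset (Fin N))).Sized (N - b) := by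
    simpa using hBs.compls
  have hle : #B ≤ N.choose (N - b) := by
    have := hBc.card_le
    rwa [card_compls, Fintype.card_fin] at this
  obtain ⟨C, hC, hCt⟩ := exists_isInitSeg_card_eq hle
  refine ⟨C, hC, hCt, ?_⟩
  -- An a-set is disjoint from a b-set iff it lies in the complement, so the admissible a-sets are
  -- those outside the iterated shadow of the complements. Initial segments minimise this shadow.
  have key : ∀ D : Finset (Finset (Fin N)), (D : Set (Finset (Fin N))).Sized (N - b) →
      (powersetCard a univ).filter (fun X : Finset (Fin N) => ∀ Y ∈ D, ¬ X ⊆ Y)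
        = powersetCard a univ \ ∂^[N - b - a] D ∧ ∂^[N - b - a] D ⊆ powersetCard a univ := by
    intro D hD
    constructor
    · ext X
      simp only [mem_filter, mem_sdiff, mem_powersetCard, subset_univ, true_and,
        mem_shadow_iterate_iff_exists_mem_card_add]
      constructor
      · rintro ⟨h1, h2⟩
        exact ⟨h1, fun ⟨Y, hY, hXY, _⟩ => h2 Y hY hXY⟩
      · rintro ⟨h1, h2⟩
        refine ⟨h1, fun Y hY hXY => h2 ⟨Y, hY, hXY, ?_⟩⟩
        have := hD hY
        omega
    · intro X hX
      obtain ⟨Y, hY, hXY, h⟩ := mem_shadow_iterate_iff_exists_mem_card_add.1 hX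
      have := hD hY
      simp only [mem_powersetCard, subset_univ, true_and]
      omega
  have h1 : A ⊆ (powersetCard a univ).filter (fun X : Finset (Fin N) => ∀ Y ∈ Bᶜˢ, ¬ X ⊆ Y) := by
    intro X hX
    simp only [mem_filter, mem_powersetCard, subset_univ, true_and]
    refine ⟨hA X hX, fun Y hY hXY => hAB X hX _ (mem_compls.1 hY) ?_⟩
    exact disjoint_compl_right.mono_left hXY
  have h2 := card_le_card h1
  have h3 := iterated_kk (k := N - b - a) hBc (by rw [card_compls, hCt] : #C ≤ _) hC
  rw [(key _ hBc).1, card_sdiff_of_subset (key _ hBc).2] at h2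
  rw [(key _ hC.1).1, card_sdiff_of_subset (key _ hC.1).2]
  omega

theorem card_avoid_last (N a : ℕ) : #(powersetCard a (univ.erase (Fin.last N))) = N.choose a := by
  rw [card_powersetCard, card_erase_of_mem (mem_univ _), card_fin, Nat.add_sub_cancel]

theorem toColex_lt_of_last {N : ℕ} {x y : Finset (Fin (N + 1))} (hx : Fin.last N ∈ x)
    (hy : Fin.last N ∉ y) : toColex y < toColex x := by
  rw [Colex.toColex_lt_toColex_iff_exists_forall_lt]
  refine ⟨Fin.last N, hx, hy, fun b hb _ => ?_⟩
  exact lt_of_le_of_ne (Fin.le_last b) (fun h => hy (h ▸ hb))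

/-- An initial segment either avoids the last element or contains all sets avoiding it. -/
theorem forall_last_notMem {N r : ℕ} {C : Finset (Finset (Fin (N + 1)))}
    (hC : Colex.IsInitSeg C r) (h : #C ≤ N.choose r) : ∀ X ∈ C, Fin.last N ∉ X := by
  intro X hX hl
  have hsub : insert X (powersetCard r (univ.erase (Fin.last N))) ⊆ C := by
    intro Y hY
    rcases mem_insert.1 hY with rfl | hY
    · exact hX
    · rw [mem_powersetCard] at hY
      exact hC.2 hX ⟨toColex_lt_of_last hl fun h => by simpa using hY.1 h, hY.2⟩
  have := card_le_card hsub
  rw [card_insert_of_notMem, card_avoid_last] at this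
  · omega
  · intro h
    have := (mem_powersetCard.1 h).1 hl
    simp at this

theorem powersetCard_avoid_last_subset {N r : ℕ} {C : Finset (Finset (Fin (N + 1)))}
    (hC : Colex.IsInitSeg C r) (h : N.choose r ≤ #C) :
    powersetCard r (univ.erase (Fin.last N)) ⊆ C := by
  by_cases hX : ∃ X ∈ C, Fin.last N ∈ X
  · obtain ⟨X, hX, hl⟩ := hX
    intro Y hY
    rw [mem_powersetCard] at hY
    exact hC.2 hX ⟨toColex_lt_of_last hl fun h => by simpa using hY.1 h, hY.2⟩
  · push Not at hX
    have hsub : C ⊆ powersetCard r (univ.erase (Fin.last N)) := by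
      intro Y hY
      rw [mem_powersetCard]
      refine ⟨fun y hy => mem_erase.2 ⟨?_, mem_univ _⟩, hC.1 hY⟩
      rintro rfl
      exact hX Y hY hy
    rw [eq_of_subset_of_card_le hsub (by rw [card_avoid_last]; exact h)]

/-- With t this small, all complements avoid the last point, so all sets of the second family
contain it and it can be removed from them. On the other side the sets through the last point are
discarded; there are at most C(N+1,a) - C(N,a) of them. -/
theorem pass_to_link {N a b s t : ℕ} (h : CrossIntersectingSizes (N + 1) a (b + 1) s t)
    (hab : a + b ≤ N) (ht : t ≤ N.choose b) :
    ∃ s', CrossIntersectingSizes N a b s' t ∧ s + N.choose a ≤ s' + (N + 1).choose a := by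
  obtain ⟨C, hC, rfl, hs⟩ := h.exists_isInitSeg (by omega)
  have hlast := forall_last_notMem hC (by
    rw [Nat.add_sub_add_right, Nat.choose_symm (by omega)]; exact ht)
  set D := (powersetCard a univ).filter (fun X : Finset (Fin (N + 1)) => ∀ Y ∈ C, ¬ X ⊆ Y) with hD
  set D' := D.filter (fun X => Fin.last N ∉ X)
  let g : Finset (Fin (N + 1)) → Finset (Fin (N + 1)) := fun Y => (univ.erase (Fin.last N)) \ Y
  have hginj : #(C.image g) = #C := by
    apply card_image_of_injOn
    intro X hX Y hY hXY
    ext x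
    by_cases hx : x = Fin.last N
    · simp [hx, hlast X hX, hlast Y hY]
    · have : x ∈ g X ↔ x ∈ g Y := by rw [show g X = g Y from hXY]
      simp only [g, mem_sdiff, mem_erase, mem_univ, ne_eq, hx, not_false_eq_true, and_true,
        true_and, not_iff_not] at this
      exact this
  refine ⟨#D', ?_, ?_⟩
  · rw [← hginj]
    refine of_finset (univ.erase (Fin.last N)) (by simp) ?_ ?_ ?_
    · intro X hX
      simp only [D', hD, mem_filter, mem_powersetCard, subset_univ, true_and] at hX
      rw [mem_powersetCard]
      refine ⟨fun x hx => mem_erase.2 ⟨?_, mem_univ _⟩, hX.1.1⟩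
      rintro rfl
      exact hX.2 hx
    · intro Y₀ hY₀
      obtain ⟨Y, hY, rfl⟩ := mem_image.1 hY₀
      rw [mem_powersetCard]
      refine ⟨sdiff_subset, ?_⟩
      have hsub : Y ⊆ univ.erase (Fin.last N) := fun y hy => mem_erase.2 ⟨by
        rintro rfl; exact hlast Y hY hy, mem_univ _⟩
      have := hC.1 hY
      rw [card_sdiff_of_subset hsub, card_erase_of_mem (mem_univ _), card_fin]
      omega
    · intro X hX Y₀ hY₀ hdis
      obtain ⟨Y, hY, rfl⟩ := mem_image.1 hY₀
      simp only [D', hD, mem_filter, mem_powersetCard, subset_univ, true_and] at hX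
      refine hX.1.2 Y hY fun x hx => ?_
      by_contra hxY
      refine disjoint_left.1 hdis hx (mem_sdiff.2 ⟨mem_erase.2 ⟨?_, mem_univ _⟩, hxY⟩)
      rintro rfl
      exact hX.2 hx
  · have h1 : #D = #D' + #(D.filter (fun X => Fin.last N ∈ X)) := by
      exact ((Nat.add_comm _ _).trans
        (card_filter_add_card_filter_not (s := D) (fun X => Fin.last N ∈ X))).symm
    have h2 : #(D.filter (fun X => Fin.last N ∈ X)) + N.choose a ≤ (N + 1).choose a := by
      rw [← card_avoid_last, ← card_union_of_disjoint]
      · calc _ ≤ #(powersetCard a (univ : Finset (Fin (N + 1)))) := by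
              apply card_le_card
              apply union_subset
              · exact (filter_subset _ _).trans (filter_subset _ _)
              · exact powersetCard_mono (erase_subset _ _)
          _ = _ := by rw [card_powersetCard, card_fin]
      · rw [disjoint_left]
        intro X hX hX'
        have := (mem_powersetCard.1 hX').1 (mem_filter.1 hX).2
        simp at this
    omega

/-- With t this large, the second family has every set through the last point, which forces that
point into every set of the first. These N.choose b sets then impose nothing more and are dropped.
-/
theorem pass_to_deletion {N a b s t : ℕ} (h : CrossIntersectingSizes (N + 1) (a + 1) (b + 1) s t)
    (hab : a + b + 1 ≤ N) (ht : N.choose b ≤ t) :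
    CrossIntersectingSizes N a (b + 1) s (t - N.choose b) := by
  obtain ⟨C, hC, rfl, hs⟩ := h.exists_isInitSeg (by omega)
  rw [← Nat.choose_symm (show b ≤ N by omega)] at ht
  rw [Nat.add_sub_add_right] at hC
  have hlast := powersetCard_avoid_last_subset hC ht
  set D := (powersetCard (a + 1) univ).filter
    (fun X : Finset (Fin (N + 1)) => ∀ Y ∈ C, ¬ X ⊆ Y) with hD
  have hDl : ∀ X ∈ D, #X = a + 1 ∧ (∀ Y ∈ C, ¬ X ⊆ Y) ∧ Fin.last N ∈ X := by
    intro X hX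
    simp only [hD, mem_filter, mem_powersetCard, subset_univ, true_and] at hX
    refine ⟨hX.1, hX.2, ?_⟩
    -- A set X missing the last point would extend to an (N-b)-set that also misses it, and all of
    -- those belong to C.
    by_contra hl
    have hsub : X ⊆ univ.erase (Fin.last N) := fun x hx => mem_erase.2 ⟨by
      rintro rfl; exact hl hx, mem_univ _⟩
    obtain ⟨Y, hXY, hY, hYc⟩ := exists_subsuperset_card_eq hsub (n := N - b) (by omega) (by
      rw [card_erase_of_mem (mem_univ _), card_fin]; omega)
    exact hX.2 Y (hlast (mem_powersetCard.2 ⟨hY, hYc⟩)) hXY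
  set C' := C.filter (fun X => Fin.last N ∈ X)
  have hC' : #C' = #C - N.choose b := by
    have h1 : #C = #C' + #(C.filter (fun X => Fin.last N ∉ X)) := by
      rw [card_filter_add_card_filter_not]
    have h2 : C.filter (fun X => Fin.last N ∉ X) = powersetCard (N - b) (univ.erase (Fin.last N)) := by
      ext X
      rw [mem_filter, mem_powersetCard]
      constructor
      · rintro ⟨hX, hl⟩
        refine ⟨fun x hx => mem_erase.2 ⟨by rintro rfl; exact hl hx, mem_univ _⟩, hC.1 hX⟩
      · rintro ⟨h1, h2⟩
        exact ⟨hlast (mem_powersetCard.2 ⟨h1, h2⟩), fun h => by simpa using h1 h⟩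
    rw [h2, card_avoid_last, Nat.choose_symm (by omega)] at h1
    omega
  have hginj : #(C'.image compl) = #C' := card_image_of_injective _ compl_injective
  have hDinj : #(D.image (fun X => X.erase (Fin.last N))) = #D := by
    apply card_image_of_injOn
    intro X hX Y hY hXY
    rw [← insert_erase (hDl X hX).2.2, ← insert_erase (hDl Y hY).2.2]
    exact congrArg _ hXY
  rw [← hC', ← hginj]
  refine mono (of_finset (A := D.image (fun X => X.erase (Fin.last N)))
    (univ.erase (Fin.last N)) (by simp) ?_ ?_ ?_) (hDinj ▸ hs) le_rfl
  · intro X₀ hX₀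
    obtain ⟨X, hX, rfl⟩ := mem_image.1 hX₀
    rw [mem_powersetCard, card_erase_of_mem (hDl X hX).2.2, (hDl X hX).1]
    exact ⟨erase_subset_erase _ (subset_univ _), rfl⟩
  · intro Y₀ hY₀
    obtain ⟨Y, hY, rfl⟩ := mem_image.1 hY₀
    have hY' := mem_filter.1 hY
    rw [mem_powersetCard]
    refine ⟨fun x hx => mem_erase.2 ⟨?_, mem_univ _⟩, ?_⟩
    · rintro rfl
      exact mem_compl.1 hx hY'.2
    · have := hC.1 hY'.1
      rw [card_compl, Fintype.card_fin]
      omega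
  · intro X₀ hX₀ Y₀ hY₀ hdis
    obtain ⟨X, hX, rfl⟩ := mem_image.1 hX₀
    obtain ⟨Y, hY, rfl⟩ := mem_image.1 hY₀
    have hY' := mem_filter.1 hY
    refine (hDl X hX).2.1 Y hY'.1 fun x hx => ?_
    by_cases hxl : x = Fin.last N
    · exact hxl ▸ hY'.2
    · by_contra hxY
      exact disjoint_left.1 hdis (mem_erase.2 ⟨hxl, hx⟩) (mem_compl.2 hxY)

end CrossIntersectingSizes

/-! ### Two binomial inequalities -/

theorem choose_le_choose_of_add_le {n i j : ℕ} (hij : i ≤ j) (hn : i + j ≤ n) :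
    n.choose i ≤ n.choose j := by
  induction n generalizing i j with
  | zero =>
    obtain rfl : i = 0 := by omega
    obtain rfl : j = 0 := by omega
    rfl
  | succ n ih =>
    rcases i with _ | i
    · rw [Nat.choose_zero_right]
      exact Nat.choose_pos (by omega)
    · obtain ⟨j, rfl⟩ : ∃ j', j = j' + 1 := ⟨j - 1, by omega⟩
      rcases Nat.lt_or_ge (i + j + 1) n with h | h
      · rw [Nat.choose_succ_succ, Nat.choose_succ_succ]
        exact add_le_add (ih (by omega) (by omega)) (ih (by omega) (by omega))
      · rcases Nat.lt_or_ge (i + j + 2) (n + 1) with h' | h'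
        · rw [Nat.choose_succ_succ, Nat.choose_succ_succ]
          exact add_le_add (ih (by omega) (by omega)) (ih (by omega) (by omega))
        · rw [← Nat.choose_symm_of_eq_add (show n + 1 = (i + 1) + (j + 1) by omega)]

/-- This is the Hilton-Milner bound in the degenerate case where the b-sets are absent and all
a-sets are present. It also makes the u = 3 bound imply the one for u = 4. -/
theorem choose_add_choose_sub_le {m a b : ℕ} (hab : a < b) (hm : a + b ≤ m) :
    m.choose a + (m - a).choose b ≤ m.choose b + 1 := by
  induction a generalizing m b with
  | zero => simp [add_comm]
  | succ a ih =>
    obtain ⟨m, rfl⟩ : ∃ m', m = m' + 1 := ⟨m - 1, by omega⟩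
    obtain ⟨b, rfl⟩ : ∃ b', b = b' + 1 := ⟨b - 1, by omega⟩
    have h1 := @ih m (b + 1) (by omega) (by omega)
    have h2 : m.choose (a + 1) ≤ m.choose b := choose_le_choose_of_add_le (by omega) (by omega)
    rw [Nat.choose_succ_succ, Nat.choose_succ_succ, Nat.add_sub_add_right]
    simp only [Nat.succ_eq_add_one]
    omega

/-! ### Hilton-Milner type bounds -/

namespace CrossIntersectingSizes

open Finset

theorem right_le {N a b s t : ℕ} (h : CrossIntersectingSizes N a b s t) : t ≤ N.choose b := by
  obtain ⟨A, B, hA, hB, hAB, hsA, rfl⟩ := h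
  have := card_le_card (show B ⊆ powersetCard b univ from fun Y hY =>
    mem_powersetCard.2 ⟨subset_univ _, hB Y hY⟩)
  rwa [card_powersetCard, card_fin] at this

theorem left_le {N a b s t : ℕ} (h : CrossIntersectingSizes N a b s t) : s ≤ N.choose a :=
  h.symm.right_le

theorem left_eq_zero {N a s t : ℕ} (h : CrossIntersectingSizes N a 0 s t) (ht : 1 ≤ t) :
    s = 0 := by
  obtain ⟨A, B, hA, hB, hAB, hsA, rfl⟩ := h
  obtain ⟨Y, hY⟩ := card_pos.1 ht
  have hA0 : A = ∅ := by
    by_contra hne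
    obtain ⟨X, hX⟩ := nonempty_iff_ne_empty.2 hne
    refine hAB X hX Y hY ?_
    rw [card_eq_zero.1 (hB Y hY)]
    exact disjoint_empty_right _
  rw [hA0] at hsA
  simpa using hsA

/-- The Hilton-Milner bound for non-empty cross-intersecting families. -/
theorem add_le_of_pos {m a b s t : ℕ} (h : CrossIntersectingSizes m b a s t) (hab : a ≤ b)
    (hm : a + b ≤ m) (hs : 1 ≤ s) (ht : 1 ≤ t) :
    s + t + (m - a).choose b ≤ m.choose b + 1 := by
  induction m generalizing a b s t with
  | zero =>
    obtain rfl : a = 0 := by omega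
    have := h.left_eq_zero ht
    omega
  | succ m ih =>
    rcases a with _ | a
    · have := h.left_eq_zero ht
      omega
    obtain ⟨b, rfl⟩ : ∃ b', b = b' + 1 := ⟨b - 1, by omega⟩
    rw [Nat.add_sub_add_right]
    -- The link case, stated for arbitrary sizes because it is also needed with the two families
    -- exchanged. The link may leave no b-sets, which is where `choose_add_choose_sub_le` enters.
    have key : ∀ s t : ℕ, CrossIntersectingSizes (m + 1) (b + 1) (a + 1) s t → 1 ≤ t →
        t ≤ m.choose a → s + t + (m - a).choose (b + 1) ≤ (m + 1).choose (b + 1) + 1 := by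
      intro s t h ht hta
      obtain ⟨s', h', hs'⟩ := h.pass_to_link (by omega) hta
      rcases Nat.eq_zero_or_pos s' with rfl | hpos
      · have := @choose_add_choose_sub_le m a (b + 1) (by omega) (by omega)
        omega
      · have := ih h' (by omega) (by omega) hpos ht
        omega
    rcases Nat.lt_or_ge (m.choose a) t with hta | hta
    · have hd := h.pass_to_deletion (by omega) hta.le
      rcases hab.lt_or_eq with hlt | heq
      · have h1 := ih hd (by omega) (by omega) hs (by omega)
        have h2 := @choose_add_choose_sub_le m a (b + 1) (by omega) (by omega)
        have h3 : 0 < (m - (a + 1)).choose b := Nat.choose_pos (by omega)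
        rw [Nat.choose_succ_succ]
        simp only [Nat.succ_eq_add_one]
        omega
      -- For equal set sizes a deletion would break a ≤ b. It does show that s is at most `m.choose
      -- a`, so the link case applies with the roles exchanged.
      · obtain rfl : a = b := by omega
        have := key t s h.symm hs hd.left_le
        omega
    · exact key s t h ht hta

/-- Admits s = 0. Then t can be as large as `m.choose a`, which the bound tolerates if a < b; for a
= b the upper bound on t has to be assumed. -/
theorem add_le_of_lt_or_le {m a b s t : ℕ} (h : CrossIntersectingSizes m b a s t) (hab : a ≤ b)
    (hm : a + b ≤ m) (ht : 1 ≤ t) (h' : a < b ∨ t + (m - a).choose b ≤ m.choose b + 1) :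
    s + t + (m - a).choose b ≤ m.choose b + 1 := by
  rcases Nat.eq_zero_or_pos s with rfl | hs
  · rcases h' with h' | h'
    · have := h.right_le
      have := choose_add_choose_sub_le h' hm
      omega
    · omega
  · exact h.add_le_of_pos hab hm hs ht

theorem add_le {m a s t : ℕ} (h : CrossIntersectingSizes m a a s t) (hm : a + a ≤ m) :
    s + t ≤ m.choose a := by
  have h1 := h.right_le
  have h2 := h.left_le
  rcases Nat.eq_zero_or_pos s with rfl | hs
  · omega
  rcases Nat.eq_zero_or_pos t with rfl | ht
  · omega
  have h3 := h.add_le_of_pos le_rfl hm hs ht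
  have h4 : 0 < (m - a).choose a := Nat.choose_pos (by omega)
  omega

theorem pass_to_iterated_link {M r a b s t : ℕ} (h : CrossIntersectingSizes (M + r) a (b + r) s t)
    (hab : a + b ≤ M) (ht : t ≤ M.choose b) :
    ∃ s', CrossIntersectingSizes M a b s' t ∧ s + M.choose a ≤ s' + (M + r).choose a := by
  induction r generalizing s with
  | zero => exact ⟨s, h, le_rfl⟩
  | succ r ih =>
    have hmono : ∀ i, M.choose b ≤ (M + i).choose (b + i) := by
      intro i
      induction i with
      | zero => exact le_rfl
      | succ i ih =>
        rw [← add_assoc, ← add_assoc, Nat.choose_succ_succ]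
        exact ih.trans (Nat.le_add_right _ _)
    obtain ⟨s₁, h₁, hs₁⟩ := pass_to_link (N := M + r) (b := b + r) h (by omega)
      (ht.trans (hmono r))
    obtain ⟨s₂, h₂, hs₂⟩ := ih h₁
    refine ⟨s₂, h₂, ?_⟩
    rw [← add_assoc]
    omega

/-! ### Bounds according to the range of t -/

section Ranges

variable {M r a c s t : ℕ}

/-- The upper bound on t allows r links, the lower bound one deletion after them. -/
theorem exists_of_range (h : CrossIntersectingSizes (M + 1 + r) (a + 1) (c + 1 + r) s t)
    (hm : a + c + 1 ≤ M) (ht : M.choose c < t) (ht' : t ≤ (M + 1).choose (c + 1)) :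
    ∃ s' t', CrossIntersectingSizes M a (c + 1) s' t' ∧ 1 ≤ t' ∧ t = M.choose c + t' ∧
      s + M.choose a + M.choose (a + 1) ≤ s' + (M + 1 + r).choose (a + 1) := by
  obtain ⟨s', h', hs'⟩ := h.pass_to_iterated_link (by omega) ht'
  refine ⟨s', t - M.choose c, h'.pass_to_deletion hm ht.le, by omega, by omega, ?_⟩
  rw [Nat.choose_succ_succ M a] at hs'
  simp only [Nat.succ_eq_add_one] at hs'
  omega

theorem add_le_of_range (h : CrossIntersectingSizes (M + 1 + r) (a + 1) (c + 1 + r) s t)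
    (hca : c + 1 ≤ a) (hm : a + c + 1 ≤ M) (ht : M.choose c < t) (ht' : t ≤ (M + 1).choose (c + 1))
    (h' : c + 1 < a ∨ t + (M - (c + 1)).choose a ≤ M.choose c + M.choose a + 1) :
    s + t + M.choose (a + 1) + (M - (c + 1)).choose a
      ≤ (M + 1 + r).choose (a + 1) + M.choose c + 1 := by
  obtain ⟨s', t', h₁, ht₁, rfl, hs⟩ := h.exists_of_range hm ht ht'
  have := h₁.add_le_of_lt_or_le hca (by omega) ht₁ (by omega)
  omega

theorem add_le_of_first_range (h : CrossIntersectingSizes (M + 3) (c + 2) (c + 3) s t)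
    (hm : 2 * c + 2 ≤ M) (ht : M.choose c < t) (ht' : t ≤ (M + 1).choose (c + 1)) :
    s + t + M.choose (c + 2) ≤ (M + 3).choose (c + 2) + M.choose c := by
  obtain ⟨s', t', h₁, ht₁, rfl, hs⟩ := exists_of_range (r := 2) (a := c + 1) h (by omega) ht ht'
  have := h₁.add_le (by omega)
  simp only [add_assoc, Nat.reduceAdd] at hs
  omega

/-- Link, deletion, link: the middle step removes `(M + 1).choose (c + 1)` sets and the remainder is
at most `M.choose (c + 1)`. -/
theorem exists_of_second_range (h : CrossIntersectingSizes (M + 3) (c + 2) (c + 3) s t)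
    (hm : 2 * c + 2 ≤ M) (ht : (M + 1).choose (c + 1) < t)
    (ht' : t ≤ (M + 1).choose (c + 1) + M.choose (c + 1)) :
    ∃ s' t', CrossIntersectingSizes M (c + 1) (c + 1) s' t' ∧ 1 ≤ t' ∧
      t = (M + 1).choose (c + 1) + t' ∧
      s + M.choose (c + 1) + M.choose (c + 1) + M.choose (c + 2) ≤ s' + (M + 3).choose (c + 2) := by
  have e1 := Nat.choose_succ_succ (M + 1) (c + 1)
  have e2 := Nat.choose_succ_succ M (c + 1)
  simp only [Nat.succ_eq_add_one, add_assoc, Nat.reduceAdd] at e1 e2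
  obtain ⟨s₁, h₁, hs₁⟩ := pass_to_link (N := M + 2) (b := c + 2) h (by omega) (by omega)
  have h₂ := pass_to_deletion (N := M + 1) (b := c + 1) h₁ (by omega) ht.le
  obtain ⟨s₃, h₃, hs₃⟩ := pass_to_link (N := M) (b := c + 1) h₂ (by omega) (by omega)
  refine ⟨s₃, _, h₃, by omega, by omega, ?_⟩
  simp only [add_assoc, Nat.reduceAdd] at hs₁
  omega

theorem add_le_of_second_range (h : CrossIntersectingSizes (M + 3) (c + 2) (c + 3) s t)
    (hm : 2 * c + 2 ≤ M) (ht : (M + 1).choose (c + 1) < t)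
    (ht' : t ≤ (M + 1).choose (c + 1) + M.choose (c + 1)) :
    s + t + M.choose (c + 2) ≤ (M + 3).choose (c + 2) + M.choose c := by
  obtain ⟨s', t', h₁, ht₁, rfl, hs⟩ := h.exists_of_second_range hm ht ht'
  have := h₁.add_le (by omega)
  rw [Nat.choose_succ_succ M c]
  simp only [Nat.succ_eq_add_one]
  omega

theorem add_le_of_second_range' (h : CrossIntersectingSizes (M + 3) (c + 2) (c + 3) s t)
    (hm : 2 * c + 2 ≤ M) (ht : (M + 1).choose (c + 1) < t)
    (ht' : t + (M - (c + 1)).choose (c + 1) ≤ (M + 1).choose (c + 1) + M.choose (c + 1) + 1) :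
    s + t + M.choose (c + 2) + (M - (c + 1)).choose (c + 1)
      ≤ (M + 3).choose (c + 2) + M.choose c + 1 := by
  have h3 : 0 < (M - (c + 1)).choose (c + 1) := Nat.choose_pos (by omega)
  obtain ⟨s', t', h₁, ht₁, rfl, hs⟩ := h.exists_of_second_range hm ht (by omega)
  have := h₁.add_le_of_lt_or_le le_rfl (by omega) ht₁ (by omega)
  rw [Nat.choose_succ_succ M c] at *
  simp only [Nat.succ_eq_add_one] at *
  omega

theorem left_le_of_le_right (h : CrossIntersectingSizes (M + 2) (c + 2) (c + 2) s t)
    (hm : 2 * c + 2 ≤ M) (ht : (M + 1).choose (c + 1) ≤ t) : s ≤ (M + 1).choose (c + 1) :=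
  left_le (pass_to_deletion (N := M + 1) (b := c + 1) h (by omega) ht)

/-- One link and one deletion bring both families to (c+1)-sets on M points, where `add_le` applies.
-/
theorem add_le_two_mul (h : CrossIntersectingSizes (M + 2) (c + 2) (c + 2) s t)
    (hm : 2 * c + 2 ≤ M) (ht : M.choose c ≤ t) (ht' : t ≤ (M + 1).choose (c + 1)) :
    s + t ≤ 2 * (M + 1).choose (c + 1) := by
  have e1 := Nat.choose_succ_succ (M + 1) (c + 1)
  have e2 := Nat.choose_succ_succ M c
  simp only [Nat.succ_eq_add_one, add_assoc, Nat.reduceAdd] at e1 e2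
  obtain ⟨s₁, h₁, hs₁⟩ := pass_to_link (N := M + 1) (b := c + 1) h (by omega) ht'
  have h₂ := pass_to_deletion (N := M) (b := c) h₁ (by omega) ht
  have := h₂.add_le (by omega)
  simp only [add_assoc, Nat.reduceAdd] at hs₁
  omega

end Ranges

end CrossIntersectingSizes

/-! ### Shifted families -/

open Finset in
/-- `F` is closed under replacing an element of a member by a smaller element of `S`. -/
def IsShiftedOn {α : Type*} [LinearOrder α] (S : Finset α) (F : Finset (Finset α)) : Prop :=
  ∀ A ∈ F, ∀ j ∈ A, ∀ i ∈ S, i ∉ A → i < j → insert i (A.erase j) ∈ F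

section Shifted

open Finset
open scoped FinsetFamily

variable {α : Type*} [LinearOrder α] {S : Finset α} {Z W : Finset (Finset α)} {x : α} {a b k : ℕ}

theorem IsShiftedOn.nonMember (hZ : IsShiftedOn (insert x S) Z) (hx : ∀ y ∈ S, y < x) :
    IsShiftedOn S (Z.nonMemberSubfamily x) := by
  intro A hA j hj i hi hiA hij
  rw [mem_nonMemberSubfamily] at hA ⊢
  refine ⟨hZ A hA.1 j hj i (mem_insert_of_mem hi) hiA hij, ?_⟩
  have := (hx i hi).ne'
  simp [this, hA.2]

theorem IsShiftedOn.member (hZ : IsShiftedOn (insert x S) Z) (hx : ∀ y ∈ S, y < x) :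
    IsShiftedOn S (Z.memberSubfamily x) := by
  intro A hA j hj i hi hiA hij
  rw [mem_memberSubfamily] at hA ⊢
  have hix := (hx i hi).ne
  have hjx : j ≠ x := by
    rintro rfl
    exact hA.2 hj
  constructor
  · have := hZ _ hA.1 j (mem_insert_of_mem hj) i (mem_insert_of_mem hi) (by simp [hix, hiA]) hij
    rwa [erase_insert_of_ne hjx.symm, Finset.insert_comm] at this
  · simp [hix.symm, hA.2]

theorem IsShiftedOn.insert_mem (hZ : IsShiftedOn (insert x S) Z) (hx : ∀ y ∈ S, y < x)
    {A : Finset α} (hA : A ∈ Z.memberSubfamily x) {c : α} (hc : c ∈ S) (hcA : c ∉ A) :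
    insert c A ∈ Z := by
  rw [mem_memberSubfamily] at hA
  have := hZ _ hA.1 x (mem_insert_self _ _) c (mem_insert_of_mem hc)
    (by simp [(hx c hc).ne, hcA]) (hx c hc)
  rwa [erase_insert hA.2] at this

theorem nonMemberSubfamily_subset_powersetCard (hZ : Z ⊆ powersetCard k (insert x S)) :
    Z.nonMemberSubfamily x ⊆ powersetCard k S := by
  intro A hA
  rw [mem_nonMemberSubfamily] at hA
  have := mem_powersetCard.1 (hZ hA.1)
  rw [mem_powersetCard]
  refine ⟨fun y hy => (mem_insert.1 (this.1 hy)).resolve_left ?_, this.2⟩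
  rintro rfl
  exact hA.2 hy

theorem memberSubfamily_subset_powersetCard (hZ : Z ⊆ powersetCard (k + 1) (insert x S)) :
    Z.memberSubfamily x ⊆ powersetCard k S := by
  intro A hA
  rw [mem_memberSubfamily] at hA
  have := mem_powersetCard.1 (hZ hA.1)
  rw [mem_powersetCard]
  refine ⟨fun y hy => (mem_insert.1 (this.1 (mem_insert_of_mem hy))).resolve_left ?_, ?_⟩
  · rintro rfl
    exact hA.2 hy
  · have h := this.2
    rw [card_insert_of_notMem hA.2] at h
    omega

theorem exists_mem_notMem_notMem {A B : Finset α} (h : #(A ∪ B) < #S) :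
    ∃ c ∈ S, c ∉ A ∧ c ∉ B := by
  obtain ⟨c, hc, hcAB⟩ := exists_mem_notMem_of_card_lt_card h
  rw [mem_union, not_or] at hcAB
  exact ⟨c, hc, hcAB⟩

/-- A shifted `(a - b)`-intersecting family of `a`-sets and a family of `b`-sets that cross-intersect
have together at most as many members as there are `b`-sets. -/
theorem card_add_card_le_of_isShiftedOn (hZ : Z ⊆ powersetCard a S) (hW : W ⊆ powersetCard b S)
    (hsh : IsShiftedOn S Z) (hcross : ∀ A ∈ Z, ∀ B ∈ W, ¬ Disjoint A B)
    (hint : ∀ A ∈ Z, ∀ B ∈ Z, a ≤ #(A ∩ B) + b) (hba : b ≤ a) (hab : a + b ≤ #S) :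
    #Z + #W ≤ (#S).choose b := by
  induction S using Finset.induction_on_max generalizing a b Z W with
  | empty =>
    obtain rfl : a = 0 := by simp at hab; omega
    obtain rfl : b = 0 := by omega
    rw [powersetCard_zero] at hZ hW
    rcases subset_singleton_iff.1 hZ with rfl | rfl
    · simpa using card_le_card hW
    · rcases subset_singleton_iff.1 hW with rfl | rfl
      · simp
      · exact absurd (disjoint_empty_left _) (hcross ∅ (by simp) ∅ (by simp))
  | insert x S hx ih =>
    have hxS : x ∉ S := fun h => lt_irrefl _ (hx x h)
    rcases b with _ | b
    · have hZ1 : #Z ≤ 1 := by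
        rw [card_le_one]
        intro A hA B hB
        have hA' := (mem_powersetCard.1 (hZ hA)).2
        have hB' := (mem_powersetCard.1 (hZ hB)).2
        have := hint A hA B hB
        have h1 : A ∩ B = A := eq_of_subset_of_card_le inter_subset_left (by omega)
        have h2 : A ∩ B = B := eq_of_subset_of_card_le inter_subset_right (by omega)
        rw [← h1, h2]
      rw [powersetCard_zero] at hW
      rw [Nat.choose_zero_right]
      rcases subset_singleton_iff.1 hW with rfl | rfl
      · simpa using hZ1
      · have : Z = ∅ := by
          by_contra hne
          obtain ⟨A, hA⟩ := nonempty_iff_ne_empty.2 hne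
          exact hcross A hA ∅ (by simp) (disjoint_empty_right _)
        simp [this]
    obtain ⟨a, rfl⟩ : ∃ a', a = a' + 1 := ⟨a - 1, by omega⟩
    -- If a + b = |S|, the complements in S of the members of Z are b-sets outside W.
    rcases hab.eq_or_lt with heq | hlt
    · have hinj : #(Z.image (fun A => insert x S \ A)) = #Z := by
        apply card_image_of_injOn
        intro A hA B hB hAB
        have hA' := (mem_powersetCard.1 (hZ hA)).1
        have hB' := (mem_powersetCard.1 (hZ hB)).1
        rw [← Finset.sdiff_sdiff_eq_self hA', ← Finset.sdiff_sdiff_eq_self hB']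
        exact congrArg _ hAB
      rw [← hinj, ← card_union_of_disjoint, ← card_powersetCard]
      · apply card_le_card
        apply union_subset _ hW
        intro A₀ hA₀
        obtain ⟨A, hA, rfl⟩ := mem_image.1 hA₀
        have hA' := mem_powersetCard.1 (hZ hA)
        rw [mem_powersetCard]
        refine ⟨sdiff_subset, ?_⟩
        rw [card_sdiff_of_subset hA'.1]
        omega
      · rw [disjoint_left]
        intro A₀ hA₀ hW'
        obtain ⟨A, hA, rfl⟩ := mem_image.1 hA₀
        exact hcross A hA _ hW' disjoint_sdiff
    · rw [card_insert_of_notMem hxS] at hlt ⊢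
      have hmem : ∀ C ∈ Z.memberSubfamily x, #C = a := fun C hC =>
        (mem_powersetCard.1 (memberSubfamily_subset_powersetCard hZ hC)).2
      have hmemW : ∀ C ∈ W.memberSubfamily x, #C = b := fun C hC =>
        (mem_powersetCard.1 (memberSubfamily_subset_powersetCard hW hC)).2
      have h0 := ih (nonMemberSubfamily_subset_powersetCard hZ)
        (nonMemberSubfamily_subset_powersetCard hW) (hsh.nonMember hx)
        (fun A hA B hB => hcross A (mem_nonMemberSubfamily.1 hA).1 B (mem_nonMemberSubfamily.1 hB).1)
        (fun A hA B hB => hint A (mem_nonMemberSubfamily.1 hA).1 B (mem_nonMemberSubfamily.1 hB).1)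
        hba (by omega)
      have h1 := ih (memberSubfamily_subset_powersetCard hZ)
        (memberSubfamily_subset_powersetCard hW) (hsh.member hx)
        (fun A hA B hB hdis => by
          -- The links do not cover S. Shifting x to an uncovered c in one of the two sets removes x
          -- from the intersection, so the links themselves must meet.
          obtain ⟨c, hc, hcA, hcB⟩ := exists_mem_notMem_notMem (S := S) (A := A) (B := B) (by
            have := card_union_le A B
            have := hmem A hA
            have := hmemW B hB
            omega)
          refine hcross _ (hsh.insert_mem hx hA hc hcA) _ (mem_memberSubfamily.1 hB).1 ?_
          have hxA := (mem_memberSubfamily.1 hA).2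
          simp [hcB, (hx c hc).ne', hxA, hdis])
        (fun A hA B hB => by
          have hxA := (mem_memberSubfamily.1 hA).2
          have hxB := (mem_memberSubfamily.1 hB).2
          have h2 := hint _ (mem_memberSubfamily.1 hA).1 _ (mem_memberSubfamily.1 hB).1
          rw [← insert_inter_distrib, card_insert_of_notMem (by simp [hxA])] at h2
          by_contra hlt'
          -- The same shift: links whose intersection is one too small have a union small enough to
          -- miss some c.
          obtain ⟨c, hc, hcA, hcB⟩ := exists_mem_notMem_notMem (S := S) (A := A) (B := B) (by
            have := card_union_add_card_inter A B
            have := hmem A hA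
            have := hmem B hB
            omega)
          have h3 := hint _ (hsh.insert_mem hx hA hc hcA) _ (mem_memberSubfamily.1 hB).1
          have h4 : insert c A ∩ insert x B = A ∩ B := by
            ext y
            simp only [mem_inter, mem_insert]
            constructor
            · rintro ⟨rfl | h, rfl | h'⟩
              · exact absurd (hx _ hc) (lt_irrefl _)
              · exact absurd h' hcB
              · exact absurd h hxA
              · exact ⟨h, h'⟩
            · rintro ⟨h, h'⟩
              exact ⟨Or.inr h, Or.inr h'⟩
          rw [h4] at h3
          omega)
        (by omega) (by omega)
      rw [Nat.choose_succ_succ, ← card_memberSubfamily_add_card_nonMemberSubfamily x Z,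
        ← card_memberSubfamily_add_card_nonMemberSubfamily x W]
      simp only [Nat.succ_eq_add_one]
      omega

/-- Double counting: each member has k subsets in the shadow, and each shadow set lies in at most
|S| - k + 1 ≤ k members. -/
theorem card_le_card_shadow_of_card_lt (hZ : Z ⊆ powersetCard k S) (hk : 1 ≤ k)
    (hS : #S < 2 * k) : #Z ≤ #(∂ Z) := by
  have h : #Z * k ≤ #(∂ Z) * k := by
    refine card_mul_le_card_mul (fun A T => T ⊆ A) ?_ ?_
    · intro A hA
      rw [← (mem_powersetCard.1 (hZ hA)).2, ← card_image_of_injOn (erase_injOn A)]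
      apply card_le_card
      intro T hT
      obtain ⟨y, hy, rfl⟩ := mem_image.1 hT
      rw [mem_bipartiteAbove]
      exact ⟨erase_mem_shadow hA hy, erase_subset _ _⟩
    · intro T hT
      obtain ⟨A, hA, y, hy, rfl⟩ := mem_shadow_iff.1 hT
      have hA' := mem_powersetCard.1 (hZ hA)
      have hsub : Z.bipartiteBelow (fun A T => T ⊆ A) (A.erase y)
          ⊆ (S \ A.erase y).image (fun z => insert z (A.erase y)) := by
        intro B hB
        rw [mem_bipartiteBelow] at hB
        have hB' := mem_powersetCard.1 (hZ hB.1)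
        have hcard : #(A.erase y) + 1 = #B := by
          rw [card_erase_add_one hy, hA'.2, hB'.2]
        obtain ⟨z, hz⟩ := card_eq_one.1 (show #(B \ A.erase y) = 1 by
          rw [card_sdiff_of_subset hB.2]; omega)
        have hzB : z ∈ B \ A.erase y := hz ▸ mem_singleton_self z
        rw [mem_image]
        refine ⟨z, mem_sdiff.2 ⟨hB'.1 (mem_sdiff.1 hzB).1, (mem_sdiff.1 hzB).2⟩, ?_⟩
        rw [insert_eq, ← hz, sdiff_union_of_subset hB.2]
      have h1 := (card_le_card hsub).trans card_image_le
      rw [card_sdiff_of_subset ((erase_subset _ _).trans hA'.1), card_erase_of_mem hy, hA'.2] at h1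
      omega
  exact Nat.le_of_mul_le_mul_right h (by omega)

/-- A shifted intersecting family is at most as large as its shadow. -/
theorem card_le_card_shadow_of_isShiftedOn (hZ : Z ⊆ powersetCard k S) (hk : 1 ≤ k)
    (hsh : IsShiftedOn S Z) (hint : (Z : Set (Finset α)).Intersecting) : #Z ≤ #(∂ Z) := by
  induction S using Finset.induction_on_max generalizing k Z with
  | empty => exact card_le_card_shadow_of_card_lt hZ hk (by simp; omega)
  | insert x S hx ih =>
    have hxS : x ∉ S := fun h => lt_irrefl _ (hx x h)
    rcases Nat.lt_or_ge #(insert x S) (2 * k) with hlt | hge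
    · exact card_le_card_shadow_of_card_lt hZ hk hlt
    rw [card_insert_of_notMem hxS] at hge
    obtain ⟨k, rfl⟩ : ∃ k', k = k' + 1 := ⟨k - 1, by omega⟩
    rcases Nat.eq_zero_or_pos k with rfl | hk'
    · rcases Z.eq_empty_or_nonempty with rfl | ⟨A, hA⟩
      · simp
      · have h1 : #Z ≤ 1 := by
          rw [card_le_one]
          intro B hB C hC
          obtain ⟨y, rfl⟩ := card_eq_one.1 (mem_powersetCard.1 (hZ hB)).2
          obtain ⟨z, rfl⟩ := card_eq_one.1 (mem_powersetCard.1 (hZ hC)).2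
          have := hint hB hC
          simpa using this
        obtain ⟨y, rfl⟩ := card_eq_one.1 (mem_powersetCard.1 (hZ hA)).2
        exact h1.trans (card_pos.2 ⟨_, erase_mem_shadow hA (mem_singleton_self y)⟩)
    have hmem : ∀ C ∈ Z.memberSubfamily x, #C = k := fun C hC =>
      (mem_powersetCard.1 (memberSubfamily_subset_powersetCard hZ hC)).2
    have h0 := ih (nonMemberSubfamily_subset_powersetCard hZ) hk (hsh.nonMember hx)
      (fun A hA B hB => hint (mem_nonMemberSubfamily.1 hA).1 (mem_nonMemberSubfamily.1 hB).1)
    have h1 := ih (memberSubfamily_subset_powersetCard hZ) hk' (hsh.member hx)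
      (fun A hA B hB hdis => by
        obtain ⟨c, hc, hcA, hcB⟩ := exists_mem_notMem_notMem (S := S) (A := A) (B := B) (by
          have := card_union_le A B
          have := hmem A hA
          have := hmem B hB
          omega)
        refine hint (hsh.insert_mem hx hA hc hcA) (mem_memberSubfamily.1 hB).1 ?_
        have hxA := (mem_memberSubfamily.1 hA).2
        simp [hcB, (hx c hc).ne', hxA, hdis])
    have h2 : ∂ (Z.nonMemberSubfamily x) ⊆ (∂ Z).nonMemberSubfamily x := by
      intro T hT
      obtain ⟨A, hA, y, hy, rfl⟩ := mem_shadow_iff.1 hT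
      rw [mem_nonMemberSubfamily] at hA ⊢
      exact ⟨erase_mem_shadow hA.1 hy, fun h => hA.2 (mem_of_mem_erase h)⟩
    have h3 : ∂ (Z.memberSubfamily x) ⊆ (∂ Z).memberSubfamily x := by
      intro T hT
      obtain ⟨A, hA, y, hy, rfl⟩ := mem_shadow_iff.1 hT
      rw [mem_memberSubfamily] at hA ⊢
      have hyx : x ≠ y := by
        rintro rfl
        exact hA.2 hy
      refine ⟨?_, fun h => hA.2 (mem_of_mem_erase h)⟩
      rw [← erase_insert_of_ne hyx]
      exact erase_mem_shadow hA.1 (mem_insert_of_mem hy)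
    have h4 := card_le_card h2
    have h5 := card_le_card h3
    rw [← card_memberSubfamily_add_card_nonMemberSubfamily x Z,
      ← card_memberSubfamily_add_card_nonMemberSubfamily x (∂ Z)]
    omega

end Shifted

/-! ### Compressions -/

section Compression

open Finset
open scoped FinsetFamily

variable {α : Type*} [DecidableEq α] {i j l : α} {F : Finset (Finset α)} {A : Finset α}

theorem compress_singleton_of_mem (hi : i ∉ A) (hj : j ∈ A) :
    UV.compress {i} {j} A = insert i (A.erase j) := by
  have hij : i ≠ j := by
    rintro rfl
    exact hi hj
  rw [UV.compress_of_disjoint_of_le (by simpa using hi) (by simpa using hj)]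
  ext y
  simp only [sup_eq_union, mem_sdiff, mem_union, mem_singleton, mem_insert, mem_erase]
  constructor
  · rintro ⟨h1 | h1, h2⟩
    · exact Or.inr ⟨h2, h1⟩
    · exact Or.inl h1
  · rintro (rfl | ⟨h1, h2⟩)
    · exact ⟨Or.inr rfl, hij⟩
    · exact ⟨Or.inl h2, h1⟩

theorem compress_singleton_of_not (h : ¬ (i ∉ A ∧ j ∈ A)) : UV.compress {i} {j} A = A := by
  rw [UV.compress, if_neg]
  simpa using h

theorem exists_of_mem_compression_of_notMem (hA : A ∈ 𝓒 {i} {j} F) (hAF : A ∉ F) :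
    ∃ B ∈ F, i ∉ B ∧ j ∈ B ∧ A = insert i (B.erase j) := by
  rcases UV.mem_compression.1 hA with h | ⟨-, B, hB, h⟩
  · exact absurd h.1 hAF
  · by_cases hc : i ∉ B ∧ j ∈ B
    · rw [compress_singleton_of_mem hc.1 hc.2] at h
      exact ⟨B, hB, hc.1, hc.2, h.symm⟩
    · rw [compress_singleton_of_not hc] at h
      exact absurd (h ▸ hB) hAF

theorem compress_mem_of_mem_compression (hA : A ∈ 𝓒 {i} {j} F) (hAF : A ∈ F) (hi : i ∉ A)
    (hj : j ∈ A) : insert i (A.erase j) ∈ F := by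
  rcases UV.mem_compression.1 hA with h | h
  · rw [compress_singleton_of_mem hi hj] at h
    exact h.2
  · exact absurd hAF h.1

theorem intersecting_compression (hij : i ≠ j) (hF : (F : Set (Finset α)).Intersecting) :
    ((𝓒 {i} {j} F : Finset (Finset α)) : Set (Finset α)).Intersecting := by
  have key : ∀ A ∈ 𝓒 {i} {j} F, ∀ B ∈ 𝓒 {i} {j} F, A ∈ F → B ∉ F → ¬ Disjoint A B := by
    intro A hA B hB hAF hBF hdis
    obtain ⟨B, hB', hiB, hjB, rfl⟩ := exists_of_mem_compression_of_notMem hB hBF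
    rw [disjoint_insert_right] at hdis
    have hdis' : ∀ y ∈ A, y ∈ B → y = j := fun y hyA hyB => by
      by_contra hne
      exact disjoint_left.1 hdis.2 hyA (mem_erase.2 ⟨hne, hyB⟩)
    -- If j ∈ A, then A stayed in place only because its compressed set is already in F, and that
    -- set is disjoint from the original B.
    by_cases hjA : j ∈ A
    · refine hF (compress_mem_of_mem_compression hA hAF hdis.1 hjA) hB' ?_
      rw [disjoint_left]
      intro y hy hyB
      rcases mem_insert.1 hy with rfl | hy
      · exact hiB hyB
      · exact (mem_erase.1 hy).1 (hdis' y (mem_erase.1 hy).2 hyB)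
    · refine hF hAF hB' ?_
      rw [disjoint_left]
      intro y hy hyB
      exact hjA (hdis' y hy hyB ▸ hy)
  intro A hA B hB
  by_cases hAF : A ∈ F <;> by_cases hBF : B ∈ F
  · exact hF hAF hBF
  · exact key A hA B hB hAF hBF
  · exact fun h => key B hB A hA hBF hAF h.symm
  · obtain ⟨A, -, -, -, rfl⟩ := exists_of_mem_compression_of_notMem hA hAF
    obtain ⟨B, -, -, -, rfl⟩ := exists_of_mem_compression_of_notMem hB hBF
    simp

theorem subset_nonMemberSubfamily_compression_left :
    (F.nonMemberSubfamily j).nonMemberSubfamily i ⊆ (𝓒 {i} {j} F).nonMemberSubfamily i := by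
  intro A hA
  simp only [mem_nonMemberSubfamily] at hA ⊢
  have := UV.compress_mem_compression (u := {i}) (v := {j}) hA.1.1
  rw [compress_singleton_of_not fun h => hA.1.2 h.2] at this
  exact ⟨this, hA.2⟩

/-- Compressing a set that avoids l ≠ i never introduces l, so the degree of no point other than i
goes up; l = j is included. -/
theorem card_nonMemberSubfamily_le_compression (hi : l ≠ i) :
    #(F.nonMemberSubfamily l) ≤ #((𝓒 {i} {j} F).nonMemberSubfamily l) := by
  rw [← UV.card_compression {i} {j} (F.nonMemberSubfamily l)]
  apply card_le_card
  intro A hA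
  by_cases hAF : A ∈ F.nonMemberSubfamily l
  · rcases UV.mem_compression.1 hA with h | h
    · have h1 := mem_nonMemberSubfamily.1 h.1
      have h2 := mem_nonMemberSubfamily.1 h.2
      exact mem_nonMemberSubfamily.2 ⟨UV.mem_compression.2 (Or.inl ⟨h1.1, h2.1⟩), h1.2⟩
    · exact absurd hAF h.1
  · obtain ⟨B, hB, hiB, hjB, rfl⟩ := exists_of_mem_compression_of_notMem hA hAF
    have hB' := mem_nonMemberSubfamily.1 hB
    have hl : l ∉ insert i (B.erase j) := by simp [hi, hB'.2]
    refine mem_nonMemberSubfamily.2 ⟨UV.mem_compression.2 (Or.inr ⟨fun h => hAF ?_, B, hB'.1, ?_⟩), hl⟩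
    · exact mem_nonMemberSubfamily.2 ⟨h, hl⟩
    · exact compress_singleton_of_mem hiB hjB

/-- The decreasing weight that makes repeated compression terminate. -/
theorem sum_sum_compression_lt {n : ℕ} {i j : Fin n} {F : Finset (Finset (Fin n))} (hij : i < j)
    (hne : 𝓒 {i} {j} F ≠ F) :
    ∑ A ∈ 𝓒 {i} {j} F, ∑ y ∈ A, (y : ℕ) < ∑ A ∈ F, ∑ y ∈ A, (y : ℕ) := by
  have hu : F.filter (fun A => UV.compress {i} {j} A ∈ F) ∪
      F.filter (fun A => UV.compress {i} {j} A ∉ F) = F := filter_union_filter_not_eq _ _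
  have hnonempty : (F.filter (fun A => UV.compress {i} {j} A ∉ F)).Nonempty := by
    by_contra! h
    apply hne
    rw [UV.compression, filter_image, h, image_empty, union_empty]
    rwa [h, union_empty] at hu
  conv_rhs => rw [← hu]
  rw [UV.compression, sum_union UV.compress_disjoint, sum_union (disjoint_filter_filter_not _ _ _),
    add_lt_add_iff_left, filter_image, sum_image UV.compress_injOn]
  refine sum_lt_sum_of_nonempty hnonempty fun A hA => ?_
  rw [mem_filter] at hA
  by_cases hc : i ∉ A ∧ j ∈ A
  · rw [compress_singleton_of_mem hc.1 hc.2, sum_insert (fun h => hc.1 (mem_of_mem_erase h)),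
      ← add_sum_erase A _ hc.2]
    exact Nat.add_lt_add_right hij _
  · rw [compress_singleton_of_not hc] at hA
    exact absurd hA.1 hA.2

theorem isShiftedOn_of_forall_compression_eq {n : ℕ} {F : Finset (Finset (Fin n))}
    (h : ∀ i j : Fin n, i < j → 𝓒 {i} {j} F = F) : IsShiftedOn univ F := by
  intro A hA j hj i _ hi hij
  have := UV.compress_mem_compression (u := {i}) (v := {j}) hA
  rwa [compress_singleton_of_mem hi hj, h i j hij] at this

end Compression

/-! ### Diversity and vertex links -/

section Diversity

open Finset

variable {n : ℕ} (F : Finset (Finset (Fin n)))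

theorem familyDegree_add_card_nonMemberSubfamily (i : Fin n) :
    familyDegree F i + #(F.nonMemberSubfamily i) = #F :=
  card_filter_add_card_filter_not _

theorem diversity_le_card_nonMemberSubfamily (i : Fin n) :
    diversity F ≤ #(F.nonMemberSubfamily i) := by
  have h1 := familyDegree_add_card_nonMemberSubfamily F i
  have h2 : familyDegree F i ≤ familyMaxDegree F := le_sup (f := familyDegree F) (mem_univ i)
  rw [diversity]
  omega

theorem exists_card_nonMemberSubfamily_eq_diversity (hn : 0 < n) :
    ∃ i, #(F.nonMemberSubfamily i) = diversity F := by
  obtain ⟨i, -, hi⟩ := exists_mem_eq_sup (univ : Finset (Fin n)) ⟨⟨0, hn⟩, mem_univ _⟩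
    (familyDegree F)
  refine ⟨i, ?_⟩
  have h1 := familyDegree_add_card_nonMemberSubfamily F i
  rw [diversity, familyMaxDegree, hi]
  omega

variable {F}

theorem lt_diversity_of_forall (hn : 0 < n) {t : ℕ} (h : ∀ i, t < #(F.nonMemberSubfamily i)) :
    t < diversity F := by
  obtain ⟨i, hi⟩ := exists_card_nonMemberSubfamily_eq_diversity F hn
  exact hi ▸ h i

/-- The links of the members containing and avoiding a vertex of maximal degree. -/
theorem exists_crossIntersectingSizes_diversity {N a : ℕ} {F : Finset (Finset (Fin (N + 1)))}
    (hF : F ⊆ powersetCard (a + 1) univ) (hint : (F : Set (Finset (Fin (N + 1)))).Intersecting) :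
    ∃ s, CrossIntersectingSizes N a (a + 1) s (diversity F) ∧ #F = s + diversity F := by
  obtain ⟨x, hx⟩ := exists_card_nonMemberSubfamily_eq_diversity F (Nat.succ_pos _)
  rw [← hx]
  refine ⟨#(F.memberSubfamily x), ?_, (card_memberSubfamily_add_card_nonMemberSubfamily x F).symm⟩
  rw [← insert_erase (mem_univ x)] at hF
  refine .of_finset (univ.erase x) (by simp) (memberSubfamily_subset_powersetCard hF)
    (nonMemberSubfamily_subset_powersetCard hF) fun X hX Y hY hdis => ?_
  rw [mem_memberSubfamily] at hX
  rw [mem_nonMemberSubfamily] at hY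
  exact hint hX.1 hY.1 (by simp [hdis, hY.2])

theorem card_eq_add_four (F : Finset (Finset (Fin n))) {i j : Fin n} (hij : i ≠ j) :
    #F = #((F.memberSubfamily j).memberSubfamily i) + #((F.nonMemberSubfamily j).memberSubfamily i)
      + #((F.nonMemberSubfamily i).memberSubfamily j)
      + #((F.nonMemberSubfamily j).nonMemberSubfamily i) ∧
    #(F.nonMemberSubfamily i) = #((F.nonMemberSubfamily i).memberSubfamily j)
      + #((F.nonMemberSubfamily j).nonMemberSubfamily i) := by
  have h1 := card_memberSubfamily_add_card_nonMemberSubfamily j F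
  have h2 := card_memberSubfamily_add_card_nonMemberSubfamily i (F.memberSubfamily j)
  have h3 := card_memberSubfamily_add_card_nonMemberSubfamily i (F.nonMemberSubfamily j)
  have h4 := card_memberSubfamily_add_card_nonMemberSubfamily j (F.nonMemberSubfamily i)
  have h5 : (F.nonMemberSubfamily i).nonMemberSubfamily j =
      (F.nonMemberSubfamily j).nonMemberSubfamily i := by
    ext A
    simp only [mem_nonMemberSubfamily]
    tauto
  have h6 : (F.memberSubfamily j).nonMemberSubfamily i =
      (F.nonMemberSubfamily i).memberSubfamily j := by
    ext A
    simp only [mem_nonMemberSubfamily, mem_memberSubfamily, mem_insert, hij, false_or]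
    tauto
  rw [h5] at h4
  rw [h6] at h2
  omega

/-! ### The bound for u = 3, with n = M + 4 and k = c + 3 -/

section Pair

variable {M c : ℕ} {F : Finset (Finset (Fin (M + 4)))} {i j : Fin (M + 4)}

theorem subset_powersetCard_insert_insert (hij : i ≠ j) {k : ℕ} (hF : F ⊆ powersetCard k univ) :
    F ⊆ powersetCard k (insert i (insert j ((univ.erase j).erase i))) := by
  rwa [Finset.insert_comm, insert_erase (by simp [hij]), insert_erase (mem_univ _)]

theorem crossIntersectingSizes_pair (hij : i ≠ j) (hF : F ⊆ powersetCard (c + 3) univ)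
    (hint : (F : Set (Finset (Fin (M + 4)))).Intersecting) :
    CrossIntersectingSizes (M + 2) (c + 2) (c + 2) #((F.nonMemberSubfamily j).memberSubfamily i)
      #((F.nonMemberSubfamily i).memberSubfamily j) := by
  have hF' := subset_powersetCard_insert_insert hij hF
  refine .of_finset ((univ.erase j).erase i) ?_ ?_ ?_ fun X hX Y hY hdis => ?_
  · rw [card_erase_of_mem (by simp [hij]), card_erase_of_mem (mem_univ _), card_fin]
    rfl
  · rw [Finset.insert_comm] at hF'
    exact memberSubfamily_subset_powersetCard (nonMemberSubfamily_subset_powersetCard hF')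
  · exact memberSubfamily_subset_powersetCard (nonMemberSubfamily_subset_powersetCard hF')
  · simp only [mem_memberSubfamily, mem_nonMemberSubfamily, mem_insert, not_or] at hX hY
    refine hint hX.1.1 hY.1.1 ?_
    simp [hX.1.2, hY.1.2, hdis]

/-- Otherwise the link of i without j and that of j without i would both exceed `(M + 1).choose (c +
1)`, which cross-intersection forbids. -/
theorem lt_card_nonMemberSubfamily_of_lt_diversity (hij : i ≠ j)
    (hF : F ⊆ powersetCard (c + 3) univ) (hint : (F : Set (Finset (Fin (M + 4)))).Intersecting)
    (hm : 2 * c + 2 ≤ M) (hd : (M + 1).choose (c + 1) + M.choose (c + 1) < diversity F) :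
    M.choose (c + 1) < #((F.nonMemberSubfamily j).nonMemberSubfamily i) := by
  by_contra! hle
  have h1 := (card_eq_add_four F hij).2
  have h2 := (card_eq_add_four F hij.symm).2
  have h3 := diversity_le_card_nonMemberSubfamily F i
  have h4 := diversity_le_card_nonMemberSubfamily F j
  have h5 : (F.nonMemberSubfamily i).nonMemberSubfamily j =
      (F.nonMemberSubfamily j).nonMemberSubfamily i := by
    ext A
    simp only [mem_nonMemberSubfamily]
    tauto
  have h6 := (crossIntersectingSizes_pair hij hF hint).left_le_of_le_right hm (by omega)
  rw [h5] at h2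
  omega

/-- Only the degree of i can grow, and the members avoiding both i and j still avoid i after
compression. -/
theorem lt_diversity_compression (hij : i ≠ j)
    (hF : F ⊆ powersetCard (c + 3) univ) (hint : (F : Set (Finset (Fin (M + 4)))).Intersecting)
    (hm : 2 * c + 2 ≤ M) (hd : (M + 1).choose (c + 1) + M.choose (c + 1) < diversity F) :
    M.choose c < diversity (UV.compression {i} {j} F) := by
  have h0 : M.choose c ≤ M.choose (c + 1) := choose_le_choose_of_add_le (by omega) (by omega)
  refine lt_diversity_of_forall (by omega) fun l => ?_
  by_cases hli : l = i
  · subst hli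
    have h1 := lt_card_nonMemberSubfamily_of_lt_diversity hij hF hint hm hd
    have h2 := card_le_card (subset_nonMemberSubfamily_compression_left (i := l) (j := j) (F := F))
    omega
  · have h1 := diversity_le_card_nonMemberSubfamily F l
    have h2 := card_nonMemberSubfamily_le_compression (F := F) (j := j) hli
    omega

/-- The members are split by their trace on {0, 1}. Those with trace ∅ or {0, 1} number at most `(M
+ 2).choose (c + 1)`, by `card_add_card_le_of_isShiftedOn`; those with a one-point trace are bounded
by `add_le_two_mul`. The sum is the size of {A : |A ∩ T| ≥ 2}, |T| = 3. -/
theorem card_le_of_isShiftedOn (hsh : IsShiftedOn univ F)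
    (hF : F ⊆ powersetCard (c + 3) univ) (hint : (F : Set (Finset (Fin (M + 4)))).Intersecting)
    (hm : 2 * c + 2 ≤ M) (hd : (M + 1).choose (c + 1) + M.choose (c + 1) < diversity F) :
    #F ≤ (M + 2).choose (c + 1) + 2 * (M + 1).choose (c + 1) := by
  have h01 : (0 : Fin (M + 4)) ≠ 1 := by simp
  set S : Finset (Fin (M + 4)) := (univ.erase 1).erase 0 with hS
  have hScard : #S = M + 2 := by
    rw [hS, card_erase_of_mem (by simp [h01]), card_erase_of_mem (mem_univ _), card_fin]
    rfl
  have hS1 : ∀ y ∈ S, 1 < y := by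
    intro y hy
    simp only [hS, mem_erase, mem_univ, and_true, ne_eq, Fin.ext_iff, Fin.val_zero,
      Fin.val_one] at hy
    rw [Fin.lt_def, Fin.val_one]
    omega
  have hS0 : ∀ y ∈ S, 0 < y := fun y hy => (Fin.zero_le _).trans_lt (hS1 y hy)
  have hF' := subset_powersetCard_insert_insert h01 hF
  rw [Finset.insert_comm] at hF'
  set Z := (F.nonMemberSubfamily 1).nonMemberSubfamily 0 with hZdef
  have hZmem : ∀ A, A ∈ Z ↔ A ∈ F ∧ 1 ∉ A ∧ 0 ∉ A := fun A => by
    simp only [hZdef, mem_nonMemberSubfamily, and_assoc]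
  have hZ : Z ⊆ powersetCard (c + 3) S :=
    nonMemberSubfamily_subset_powersetCard (nonMemberSubfamily_subset_powersetCard hF')
  have hZS : ∀ A ∈ Z, A ⊆ S := fun A hA => (mem_powersetCard.1 (hZ hA)).1
  have hW : (F.memberSubfamily 1).memberSubfamily 0 ⊆ powersetCard (c + 1) S :=
    memberSubfamily_subset_powersetCard (memberSubfamily_subset_powersetCard hF')
  have hZsh : IsShiftedOn S Z := by
    intro A hA y hy x hx hxA hxy
    rw [hZmem] at hA ⊢
    refine ⟨hsh A hA.1 y hy x (mem_univ _) hxA hxy, ?_, ?_⟩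
    · simp [(hS1 x hx).ne, hA.2.1]
    · simp [(hS0 x hx).ne, hA.2.2]
  have hZint : (Z : Set (Finset (Fin (M + 4)))).Intersecting := fun A hA B hB =>
    hint ((hZmem A).1 hA).1 ((hZmem B).1 hB).1
  have hZW := card_add_card_le_of_isShiftedOn hZ hW hZsh
    (fun A hA B hB hdis => by
      simp only [mem_memberSubfamily] at hB
      rw [hZmem] at hA
      exact hint hA.1 hB.1.1 (by simp [hA.2, hdis]))
    (fun A hA B hB => by
      -- Members avoiding 0 and 1 meet in at least two points: if x were the only common one,
      -- replacing x by 0 in A would make it disjoint from B.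
      by_contra hlt
      obtain ⟨x, hxA, hxB⟩ := not_disjoint_iff.1 (hZint hA hB)
      have hone : A ∩ B = {x} := by
        symm
        apply eq_of_subset_of_card_le
        · simpa using ⟨hxA, hxB⟩
        · rw [card_singleton]
          omega
      have hA' := (hZmem A).1 hA
      have hB' := (hZmem B).1 hB
      have := hsh A hA'.1 x hxA 0 (mem_univ _) hA'.2.2 (hS0 x (hZS A hA hxA))
      refine hint this hB'.1 ?_
      rw [disjoint_insert_left]
      refine ⟨hB'.2.2, ?_⟩
      rw [disjoint_left]
      intro y hy hyB
      have hyx : y ∈ A ∩ B := mem_inter.2 ⟨mem_of_mem_erase hy, hyB⟩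
      rw [hone, mem_singleton] at hyx
      exact (mem_erase.1 hy).1 hyx)
    (by omega) (by omega)
  rw [hScard] at hZW
  have hsub : ∀ {p q : Fin (M + 4)}, p ≠ q → (∀ y ∈ S, p < y) → (∀ A ∈ Z, p ∉ A ∧ q ∉ A) →
      Finset.shadow Z ⊆ (F.nonMemberSubfamily q).memberSubfamily p := by
    intro p q hpq hp hpqA T hT
    obtain ⟨A, hA, y, hy, rfl⟩ := mem_shadow_iff.1 hT
    obtain ⟨h1, h2⟩ := hpqA A hA
    simp only [mem_memberSubfamily, mem_nonMemberSubfamily, mem_insert, mem_erase, not_or]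
    exact ⟨⟨hsh A ((hZmem A).1 hA).1 y hy p (mem_univ _) h1 (hp y (hZS A hA hy)),
      hpq.symm, fun h => h2 h.2⟩, fun h => h1 h.2⟩
  -- Shiftedness puts the shadow of Z into both one-point links, so each of them is at least as
  -- large as Z. As a link and Z together have at least γ(F) members, each link has more than
  -- `M.choose c`, the lower bound that `add_le_two_mul` asks for.
  have hshadow := card_le_card_shadow_of_isShiftedOn hZ (by omega) hZsh hZint
  have hX := hshadow.trans (card_le_card (hsub h01 hS0 fun A hA => ((hZmem A).1 hA).2.symm))
  have hY := hshadow.trans (card_le_card (hsub h01.symm hS1 fun A hA => ((hZmem A).1 hA).2))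
  have h1 := card_eq_add_four F h01
  have h2 := card_eq_add_four F h01.symm
  have h5 : (F.nonMemberSubfamily 0).nonMemberSubfamily 1 = Z := by
    ext A
    simp only [mem_nonMemberSubfamily, hZmem]
    tauto
  rw [h5] at h2
  rw [← hZdef] at h1
  have h3 := diversity_le_card_nonMemberSubfamily F 0
  have h4 := diversity_le_card_nonMemberSubfamily F 1
  have hcross := crossIntersectingSizes_pair h01 hF hint
  have e1 := Nat.choose_succ_succ M c
  have e2 : M.choose c ≤ M.choose (c + 1) := choose_le_choose_of_add_le (by omega) (by omega)
  simp only [Nat.succ_eq_add_one] at e1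
  rcases Nat.lt_or_ge ((M + 1).choose (c + 1))
    #((F.nonMemberSubfamily 0).memberSubfamily 1) with hlt | hge
  · have h6 := hcross.left_le_of_le_right hm hlt.le
    have h7 := hcross.symm.add_le_two_mul hm (by omega) h6
    omega
  · have h7 := hcross.add_le_two_mul hm (by omega) hge
    omega

/-- The hypothesis on the diversity is weak enough to survive a compression made when the diversity
is large; when it is not, no compression is needed. -/
theorem card_add_choose_le_of_choose_lt_diversity
    (hF : F ⊆ powersetCard (c + 3) univ) (hint : (F : Set (Finset (Fin (M + 4)))).Intersecting)
    (hm : 2 * c + 2 ≤ M) (hd : M.choose c < diversity F) :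
    #F + M.choose (c + 2) ≤ (M + 3).choose (c + 2) + M.choose c := by
  induction hw : ∑ A ∈ F, ∑ y ∈ A, (y : ℕ) using Nat.strong_induction_on generalizing F with
  | _ w ih =>
    obtain ⟨s, hs, hcard⟩ := exists_crossIntersectingSizes_diversity hF hint
    rcases Nat.lt_or_ge ((M + 1).choose (c + 1)) (diversity F) with h1 | h1
    · rcases Nat.lt_or_ge ((M + 1).choose (c + 1) + M.choose (c + 1)) (diversity F) with h2 | h2
      · by_cases hc : ∀ i j : Fin (M + 4), i < j → UV.compression {i} {j} F = F
        · have h3 := card_le_of_isShiftedOn (isShiftedOn_of_forall_compression_eq hc) hF hint hm h2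
          have e1 := Nat.choose_succ_succ M c
          have e2 := Nat.choose_succ_succ M (c + 1)
          have e3 := Nat.choose_succ_succ (M + 1) (c + 1)
          have e4 := Nat.choose_succ_succ (M + 2) (c + 1)
          simp only [Nat.succ_eq_add_one, add_assoc, Nat.reduceAdd] at e1 e2 e3 e4
          omega
        · push Not at hc
          obtain ⟨i, j, hij, hne⟩ := hc
          have hF' : UV.compression {i} {j} F ⊆ powersetCard (c + 3) univ := by
            have hsz : (F : Set (Finset (Fin (M + 4)))).Sized (c + 3) := fun A hA =>
              (mem_powersetCard.1 (hF hA)).2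
            have := hsz.uvCompression (u := {i}) (v := {j}) (by simp)
            exact fun A hA => mem_powersetCard.2 ⟨subset_univ _, this hA⟩
          have := ih _ (hw ▸ sum_sum_compression_lt hij hne) hF'
            (intersecting_compression hij.ne hint)
            (lt_diversity_compression hij.ne hF hint hm h2) rfl
          rwa [UV.card_compression] at this
      · have := hs.add_le_of_second_range hm h1 h2
        omega
    · have := hs.add_le_of_first_range hm hd h1
      omega

end Pair

/-! ### Descent in u and the theorem -/

theorem card_add_le_of_choose_lt_diversity {n M c d : ℕ} (hn : n = M + 5 + d)
    {F : Finset (Finset (Fin n))} (hF : F ⊆ powersetCard (c + 4 + d) univ)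
    (hint : (F : Set (Finset (Fin n))).Intersecting) (hm : 2 * c + d + 4 ≤ M)
    (hd : M.choose c < diversity F) :
    #F + M.choose (c + d + 3) + (M - (c + 1)).choose (c + d + 2)
      ≤ (M + 4 + d).choose (c + d + 3) + M.choose c + 1 := by
  induction d generalizing M c with
  | zero =>
    subst hn
    rcases Nat.lt_or_ge ((M + 1).choose (c + 1)) (diversity F) with h | h
    · have h1 := card_add_choose_le_of_choose_lt_diversity (M := M + 1) (c := c + 1) hF hint
        (by omega) h
      -- By Pascal's rule this is what makes the u = 3 bound imply the one for u = 4.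
      have h2 := @choose_add_choose_sub_le M (c + 1) (c + 2) (by omega) (by omega)
      have e1 := Nat.choose_succ_succ M c
      have e2 := Nat.choose_succ_succ M (c + 2)
      simp only [Nat.succ_eq_add_one, add_assoc, Nat.reduceAdd, add_zero] at *
      omega
    · obtain ⟨s, hs, hcard⟩ := exists_crossIntersectingSizes_diversity (N := M + 4) hF hint
      have := CrossIntersectingSizes.add_le_of_range (M := M) (r := 3) (a := c + 2) (c := c) hs
        (by omega) (by omega) hd h (Or.inl (by omega))
      simp only [add_assoc, Nat.reduceAdd, add_zero] at *
      omega
  | succ d ih =>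
    rcases Nat.lt_or_ge ((M + 1).choose (c + 1)) (diversity F) with h | h
    · have h1 := @ih (M + 1) (c + 1) (by omega)
        (by rwa [show c + 1 + 4 + d = c + 4 + (d + 1) by omega]) (by omega) h
      have e1 := Nat.choose_succ_succ M c
      have e2 := Nat.choose_succ_succ M (c + d + 3)
      -- By Pascal's rule this makes the bound for u - 1 imply the bound for u.
      have h2 : M.choose (c + 1) ≤ M.choose (c + d + 3) :=
        choose_le_choose_of_add_le (by omega) (by omega)
      rw [show c + 1 + d + 3 = c + d + 3 + 1 by omega, show c + 1 + d + 2 = c + d + 3 by omega,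
        show M + 1 - (c + 1 + 1) = M - (c + 1) by omega,
        show M + 1 + 4 + d = M + 4 + (d + 1) by omega] at h1
      rw [show c + (d + 1) + 3 = c + d + 3 + 1 by omega, show c + (d + 1) + 2 = c + d + 3 by omega]
      simp only [Nat.succ_eq_add_one] at *
      omega
    · obtain rfl : n = M + 4 + (d + 1) + 1 := by omega
      obtain ⟨s, hs, hcard⟩ := exists_crossIntersectingSizes_diversity (N := M + 4 + (d + 1))
        (a := c + 3 + (d + 1)) (F := F)
        (by rwa [show c + 3 + (d + 1) + 1 = c + 4 + (d + 1) by omega]) hint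
      rw [hcard]
      generalize diversity F = t at hs hd h
      rw [show M + 4 + (d + 1) = M + 1 + (4 + d) by omega,
        show c + 3 + (d + 1) + 1 = c + 1 + (4 + d) by omega,
        show c + 3 + (d + 1) = c + d + 3 + 1 by omega] at hs
      have := hs.add_le_of_range (by omega) (by omega) hd h (Or.inl (by omega))
      rw [show c + (d + 1) + 3 = c + d + 3 + 1 by omega, show c + (d + 1) + 2 = c + d + 3 by omega,
        show M + 4 + (d + 1) = M + 1 + (4 + d) by omega]
      omega

end Diversity

theorem mainTheorem6 (n k : ℕ) (hn : 2 * k < n) (F : Finset (Finset (Fin n)))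
    (hF : F ⊆ Finset.powersetCard k Finset.univ)
    (hint : (F : Set (Finset (Fin n))).Intersecting) :
    (8 ≤ 2 * k → ∀ u : ℕ, 4 ≤ u → u ≤ k →
      (n - u - 1).choose (n - k - 1) < diversity F →
      (F.card : ℤ) ≤ ((n - 1).choose (k - 1) : ℤ) + ((n - u - 1).choose (n - k - 1) : ℤ)
        - ((n - u - 1).choose (k - 1) : ℤ) - ((n - k - 2).choose (k - 2) : ℤ) + 1) ∧
    (6 ≤ 2 * k →
      (((n - 4).choose (k - 3) < diversity F ∧
          (diversity F : ℤ) ≤ ((n - 3).choose (k - 2) : ℤ)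
            - ((n - k - 2).choose (k - 2) : ℤ) + 1) ∨
        ((n - 3).choose (k - 2) < diversity F ∧
          (diversity F : ℤ) ≤ ((n - 3).choose (k - 2) : ℤ) + ((n - 4).choose (k - 2) : ℤ)
            - ((n - k - 2).choose (k - 2) : ℤ) + 1)) →
      (F.card : ℤ) ≤ ((n - 1).choose (k - 1) : ℤ) + ((n - 3 - 1).choose (n - k - 1) : ℤ)
        - ((n - 3 - 1).choose (k - 1) : ℤ) - ((n - k - 2).choose (k - 2) : ℤ) + 1) := by
  constructor
  · intro hk u hu huk hd
    -- Here d = u - 4, c = k - u and M = n - u - 1, so that C(n-u-1, n-k-1) = C(M, c).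
    obtain ⟨d, rfl⟩ : ∃ d, u = d + 4 := ⟨u - 4, by omega⟩
    obtain ⟨c, rfl⟩ : ∃ c, k = c + 4 + d := ⟨k - 4 - d, by omega⟩
    obtain ⟨M, rfl⟩ : ∃ M, n = M + 5 + d := ⟨n - 5 - d, by omega⟩
    rw [show M + 5 + d - (d + 4) - 1 = M by omega,
      show M + 5 + d - (c + 4 + d) - 1 = M - c by omega, Nat.choose_symm (by omega)] at hd ⊢
    rw [show M + 5 + d - 1 = M + 4 + d by omega, show c + 4 + d - 1 = c + d + 3 by omega,
      show M + 5 + d - (c + 4 + d) - 2 = M - (c + 1) by omega,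
      show c + 4 + d - 2 = c + d + 2 by omega]
    have := card_add_le_of_choose_lt_diversity rfl hF hint (by omega) hd
    zify at this
    linarith
  · intro hk hd
    obtain ⟨c, rfl⟩ : ∃ c, k = c + 3 := ⟨k - 3, by omega⟩
    obtain ⟨M, rfl⟩ : ∃ M, n = M + 4 := ⟨n - 4, by omega⟩
    rw [show M + 4 - 3 - 1 = M by omega, show M + 4 - (c + 3) - 1 = M - c by omega,
      Nat.choose_symm (by omega), show M + 4 - (c + 3) - 2 = M - (c + 1) by omega]
    simp only [Nat.add_sub_cancel, show M + 4 - 3 = M + 1 by omega, show c + 3 - 2 = c + 1 by omega,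
      show M + 4 - 1 = M + 3 by omega, show c + 3 - 1 = c + 2 by omega,
      show M + 4 - (c + 3) - 2 = M - (c + 1) by omega] at hd ⊢
    obtain ⟨s, hs, hcard⟩ := exists_crossIntersectingSizes_diversity (N := M + 3) hF hint
    have key : F.card + M.choose (c + 2) + (M - (c + 1)).choose (c + 1)
        ≤ (M + 3).choose (c + 2) + M.choose c + 1 := by
      rcases hd with ⟨h1, h2⟩ | ⟨h1, h2⟩
      · have h3 : 0 < (M - (c + 1)).choose (c + 1) := Nat.choose_pos (by omega)
        have e1 := Nat.choose_succ_succ M c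
        simp only [Nat.succ_eq_add_one] at e1
        -- For u = 3 the reduced families have equal set sizes, so the assumed upper bound on γ(F)
        -- takes the place of strict inequality.
        have := CrossIntersectingSizes.add_le_of_range (M := M) (r := 2) (a := c + 1) (c := c) hs
          le_rfl (by omega) h1 (by omega) (Or.inr (by omega))
        simp only [add_assoc, Nat.reduceAdd] at *
        omega
      · have := hs.add_le_of_second_range' (by omega) h1 (by omega)
        omega
    zify at key
    linarith
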